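/- Let $N\ge 1$ and let $x_0<x_2<\dots<x_{2N}$ and $y_0<y_2<\dots<y_{2N}$ be the knots of a (possibly non-uniform) rectangular mesh of $N\times N$ cells $[x_{2a},x_{2a+2}]\times[y_{2b},y_{2b+2}]$, $0\le a,b<N$, of the rectangle $\Omega=(x_0,x_{2N})\times(y_0,y_{2N})$. Let $h^x_a=\tfrac12(x_{2a+2}-x_{2a})$ and $h^y_b=\tfrac12(y_{2b+2}-y_{2b})$ be the half edge lengths, and let $x_{2a+1}$, $y_{2b+1}$ be the midpoints of the mesh intervals. The grid points are $(x_i,y_j)$, $0\le i,j\le 2N$; those with $i\in\{0,2N\}$ or $j\in\{0,2N\}$ are boundary points. Consider the $Q^2$ variational difference scheme for $-\Delta u=f$ in $\Omega$, $u=g$ on $\partial\Omega$: find a continuous piecewise $Q^2$ function $\bar u$ that equals $g$ at the boundary grid points and satisfies $\mathcal A_h(\bar u,v)=\langle f,v\rangle_h$ for all continuous piecewise $Q^2$ functions $v$ vanishing on $\partial\Omega$, where $\mathcal A_h(u,v)$ and $\langle f,v\rangle_h$ are $\iint_\Omega\nabla u\cdot\nabla v$ and $\iint_\Omega fv$ evaluated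 by the $3\times 3$ Gauss--Lobatto quadrature on every cell. After division by the quadrature weights it is the linear system $\bar L_h\bar{\mathbf u}=\bar{\mathbf f}$ for the vector $\bar{\mathbf u}$ of the values at all grid points, where $\bar{\mathbf f}$ contains the values of $f$ at interior points and of $g$ at boundary points, and $(\bar L_h\bar{\mathbf u})_{i,j}=u_{i,j}$ at boundary points, $(\bar L_h\bar{\mathbf u})_{i,j}=(D^x u_{\cdot,j})_i+(D^y u_{i,\cdot})_j$ at interior points. Here, for $D=D^x$ with $h_a=h^x_a$ (and likewise for $D=D^y$ with $h_a=h^y_a$), $$(Dw)_{2a+1}=\frac{-w_{2a}+2w_{2a+1}-w_{2a+2}}{h_a^2},$$ $$(Dw)_{2a}=\frac{7\,w_{2a}}{2h_ah_{a-1}}-\frac{4\,w_{2a+1}}{h_a(h_a+h_{a-1})}-\frac{4\,w_{2a-1}}{h_{a-1}(h_a+h_{a-1})}+\frac{w_{2a+2}}{2h_a(h_a+h_{a-1})}+\frac{w_{2a-2}}{2h_{a-1}(h_a+h_{a-1})}.$$ Suppose that at every interior knot $(x_{2a},y_{2b})$, $0<a,b<N$, writing $h_a,h_{a-1}$ for $h^x_a,h^x_{a-1}$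 and $h_b,h_{b-1}$ for $h^y_b,h^y_{b-1}$ (the half edge lengths of the four adjacent cells), $$h_ah_{a-1}\ge\tfrac7{12}\max\{h_b^2,h_{b-1}^2\},\qquad h_bh_{b-1}\ge\tfrac7{12}\max\{h_a^2,h_{a-1}^2\},$$ $$\min\{h_a,h_{a-1}\}\ge\sqrt{\tfrac13}\,\max\{h_b,h_{b-1}\},\qquad \min\{h_b,h_{b-1}\}\ge\sqrt{\tfrac13}\,\max\{h_a,h_{a-1}\}.$$ Then the matrix $\bar L_h$ of the scheme is monotone, that is, it is invertible and all entries of $\bar L_h^{-1}$ are nonnegative. Moreover, the scheme satisfies the discrete maximum principle: if $(\bar L_h\bar{\mathbf u})_{i,j}\le 0$ at all interior grid points, then $\max_{\text{interior}}u_{i,j}\le\max\{0,\max_{\text{boundary}}u_{i,j}\}$. -/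

import Mathlib

/-! The `Q²` variational difference scheme for `-Δu = f` with Dirichlet data on a rectangular mesh
of `N × N` cells. The knots are `x 0 < ⋯ < x N` and `y 0 < ⋯ < y N`
(only these values of the two sequences matter), the cells are
`[x a, x (a+1)] × [y b, y (b+1)]`. -/

noncomputable section

namespace Q2Scheme

open Matrix

/-- Half of the length of the `c`-th mesh interval: a cell has edges of length `2 h`. -/
def halfLen (x : ℕ → ℝ) (c : ℕ) : ℝ := (x (c + 1) - x c) / 2

/-- Indices of the grid points `(x_i, y_j)`, `0 ≤ i, j ≤ n + 1`, where `n + 1 = 2 N`.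
An even index is a knot of the one-dimensional mesh, an odd one is the midpoint of a mesh interval.
So (odd, odd) is a cell center, (even, even) a knot, (even, odd) the center of an edge parallel
to the y-axis, and (odd, even) the center of an edge parallel to the x-axis. -/
abbrev Grid (N : ℕ) : Type := Fin (2 * N + 1) × Fin (2 * N + 1)

/-- Grid points on the boundary of the rectangle. -/
def IsBoundary {N : ℕ} (p : Grid N) : Prop :=
  (p.1 : ℕ) = 0 ∨ (p.1 : ℕ) = 2 * N ∨ (p.2 : ℕ) = 0 ∨ (p.2 : ℕ) = 2 * N

/-! ### The finite difference form -/

/-- The coefficient of `u_k` in the difference quotient replacing `-u''` at an interior point `i`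
of a one-dimensional grid with half lengths `h`:
at a midpoint (`i` odd, `h = h_{i/2}`), `(-u_{i-1} + 2 u_i - u_{i+1}) / h²`; at a knot
(`i = 2a`, with `h_a` to the right of it and `h_{a-1}` to the left of it),
`7 u_i / (2 h_a h_{a-1}) - 4 u_{i+1} / (h_a (h_a + h_{a-1})) - 4 u_{i-1} / (h_{a-1} (h_a + h_{a-1}))
 + u_{i+2} / (2 h_a (h_a + h_{a-1})) + u_{i-2} / (2 h_{a-1} (h_a + h_{a-1}))`. -/
def stencil (h : ℕ → ℝ) (i k : ℕ) : ℝ :=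
  if i % 2 = 1 then
    if k = i then 2 / h (i / 2) ^ 2
    else if k = i + 1 ∨ k + 1 = i then -(1 / h (i / 2) ^ 2)
    else 0
  else
    if k = i then 7 / (2 * h (i / 2) * h (i / 2 - 1))
    else if k = i + 1 then -(4 / (h (i / 2) * (h (i / 2) + h (i / 2 - 1))))
    else if k + 1 = i then -(4 / (h (i / 2 - 1) * (h (i / 2) + h (i / 2 - 1))))
    else if k = i + 2 then 1 / (2 * h (i / 2) * (h (i / 2) + h (i / 2 - 1)))
    else if k + 2 = i then 1 / (2 * h (i / 2 - 1) * (h (i / 2) + h (i / 2 - 1)))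
    else 0

open Classical in
/-- The full matrix `L̄_h` of the scheme: identity rows at the boundary points; the row of an
interior point is the sum of the stencils in the `x`- and in the `y`-direction, for instance with
diagonal entry `(7 h_b² + 4 h_a h_{a-1}) / (2 h_a h_{a-1} h_b²)` at the center of an edge parallel
to the y-axis. -/
def fullMatrix (N : ℕ) (x y : ℕ → ℝ) : Matrix (Grid N) (Grid N) ℝ :=
  Matrix.of fun p q =>
    if IsBoundary p then (if q = p then 1 else 0)
    else (if q.2 = p.2 then stencil (halfLen x) p.1 q.1 else 0)
      + (if q.1 = p.1 then stencil (halfLen y) p.2 q.2 else 0)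

/-! ### The variational form -/

/-- The three Gauss-Lobatto points `-1, 0, 1` of the reference interval `[-1, 1]`. -/
def glNode : Fin 3 → ℝ := ![-1, 0, 1]

/-- The corresponding quadrature weights. -/
def glWeight : Fin 3 → ℝ := ![1 / 3, 4 / 3, 1 / 3]

/-- The quadratic Lagrange basis polynomials on `[-1, 1]` with nodes `-1, 0, 1`. -/
def basisPoly (r : Fin 3) : Polynomial ℝ := Lagrange.basis Finset.univ glNode r

/-- The grid point with local indices `(r, s)` in the cell `(a, b)`. -/
def cellPoint {N : ℕ} (a b : Fin N) (r s : Fin 3) : Grid N :=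
  (⟨2 * a + r, by omega⟩, ⟨2 * b + s, by omega⟩)

/-- The value at the grid point `(k, l)` of the cell `(a, b)` of the `x`-derivative of the
`Q²` polynomial that interpolates the grid function `u` in that cell. -/
def dX {N : ℕ} (x : ℕ → ℝ) (u : Grid N → ℝ) (a b : Fin N) (k l : Fin 3) : ℝ :=
  ∑ r : Fin 3, ∑ s : Fin 3, u (cellPoint a b r s)
    * ((basisPoly r).derivative.eval (glNode k) / halfLen x a) * (basisPoly s).eval (glNode l)

/-- The same for the `y`-derivative. -/
def dY {N : ℕ} (y : ℕ → ℝ) (u : Grid N → ℝ) (a b : Fin N) (k l : Fin 3) : ℝ :=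
  ∑ r : Fin 3, ∑ s : Fin 3, u (cellPoint a b r s)
    * (basisPoly r).eval (glNode k) * ((basisPoly s).derivative.eval (glNode l) / halfLen y b)

/-- `𝒜_h(u, v)`: the `3 × 3` Gauss-Lobatto quadrature on every cell, applied to `∬ ∇u ⋅ ∇v` for the
continuous piecewise `Q²` functions with nodal values `u` and `v`. -/
def formA (N : ℕ) (x y : ℕ → ℝ) (u v : Grid N → ℝ) : ℝ :=
  ∑ a : Fin N, ∑ b : Fin N, ∑ k : Fin 3, ∑ l : Fin 3,
    (halfLen x a * glWeight k) * (halfLen y b * glWeight l)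
      * (dX x u a b k l * dX x v a b k l + dY y u a b k l * dY y v a b k l)

/-- `⟨f, v⟩_h`: the same quadrature applied to `∬ f v`. -/
def quadProd (N : ℕ) (x y : ℕ → ℝ) (f v : Grid N → ℝ) : ℝ :=
  ∑ a : Fin N, ∑ b : Fin N, ∑ k : Fin 3, ∑ l : Fin 3,
    (halfLen x a * glWeight k) * (halfLen y b * glWeight l)
      * (f (cellPoint a b k l) * v (cellPoint a b k l))

/-- `u` solves the `Q²` finite element scheme with quadrature, where `f` holds the values of the
right-hand side at the interior points and the Dirichlet data at the boundary points. -/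
def IsVariationalSolution (N : ℕ) (x y : ℕ → ℝ) (u f : Grid N → ℝ) : Prop :=
  (∀ p, IsBoundary p → u p = f p) ∧
    ∀ v : Grid N → ℝ, (∀ p, IsBoundary p → v p = 0) → formA N x y u v = quadProd N x y f v

/-! ### Monotonicity, the discrete maximum principle, and the mesh constraints -/

/-- A monotone matrix: invertible with entrywise nonnegative inverse. -/
def IsMonotone {ι : Type*} [Fintype ι] [DecidableEq ι] (A : Matrix ι ι ℝ) : Prop :=
  IsUnit A ∧ ∀ p q, 0 ≤ A⁻¹ p q

/-- The discrete maximum principle: if `(A u)_p ≤ 0` at all interior points `p`, then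
`max_{interior} u ≤ max {0, max_{boundary} u}`. -/
def DiscreteMaxPrinciple {N : ℕ} (A : Matrix (Grid N) (Grid N) ℝ) : Prop :=
  ∀ u : Grid N → ℝ, (∀ p, ¬ IsBoundary p → (A *ᵥ u) p ≤ 0) →
    ∀ p, ¬ IsBoundary p → u p ≤ max 0 (⨆ q : {q : Grid N // IsBoundary q}, u q)

/-- The constraints on the half lengths `h_{a-1}, h_a` in `x` and `h_{b-1}, h_b` in `y` of the four
cells around a knot. -/
def LocalConstraint (ha' ha hb' hb : ℝ) : Prop :=
  7 / 12 * max (hb ^ 2) (hb' ^ 2) ≤ ha * ha' ∧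
  7 / 12 * max (ha ^ 2) (ha' ^ 2) ≤ hb * hb' ∧
  √(1 / 3) * max hb hb' ≤ min ha ha' ∧
  √(1 / 3) * max ha ha' ≤ min hb hb'

/-- The constraints hold at every interior knot `(x a, y b)`, `0 < a, b < N`. -/
def MeshConstraint (N : ℕ) (x y : ℕ → ℝ) : Prop :=
  ∀ a b : ℕ, 0 < a → a < N → 0 < b → b < N →
    LocalConstraint (halfLen x (a - 1)) (halfLen x a) (halfLen y (b - 1)) (halfLen y b)

end Q2Scheme

end

/-!
The matrix `A = L̄_h` has positive off-diagonal entries (in the stencil at a knot, at the two next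
knots), so it is not an M-matrix, and the usual maximum principle argument has to be repaired.

Let `v ≥ 0` be a grid function with `A v > 0`, and suppose that `v` vanishes at an interior point `p`. The rows of
`A` at midpoints have only nonpositive off-diagonal entries in the midpoint direction; at a cell
center the inequality `A v ≥ 0` and the constraint `h_a² ≤ 3 h_b²` therefore give `v ≤ 8 v_c` at the
adjacent edge centers (`center_bound`). At an edge center these bounds show that the part of `A v`
orthogonal to the edge is at most its diagonal part, since the ratio of the weights in the knot
stencil is `4 : 1/2 = 8` (`gridDiff_knot_le`), and then `A v ≥ 0` and the constraint with the
factor `7/12` give `v ≤ 8 v_e` at the end points of the edge (`edge_bound`). Hence at `p`, whatever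
its type, the positive entries are outweighed by the negative ones and `(A v)_p ≤ 0`, a
contradiction (`pos_of_gridLap_pos`). The mesh constraints are the conditions which make the
factor `8` propagate from centers to edges and from edges to knots.

Since the scheme is exact on quadratic polynomials, `w = m - x²` with large `m` satisfies `w > 0`
and `A w > 0`. If `A u ≥ 0` and `u` is negative somewhere, then `v = u - t w` with
`t = min (u / w) < 0` contradicts the preceding paragraph, so `A u ≥ 0` implies `u ≥ 0`
(`nonneg_of_mulVec_nonneg`). This gives invertibility and nonnegativity of the inverse, and, as
interior rows of `A` sum to zero, the discrete maximum principle.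

For the equivalence with the variational form, `𝒜_h(u, v) = ⟨A u, v⟩_h` for all `v` vanishing on
the boundary (`formA_eq_quadProd`). The quadrature splits into one-dimensional sums, for which this
is a summation by parts (`sum_deriv_mul_deriv`). A variational solution is then tested with its own
residual.
-/

namespace Q2Scheme

open Matrix

/-! ### The one-dimensional difference operator -/

/-- The difference quotient replacing `-w''` at the point `i` of a one-dimensional grid with `N`
cells of half lengths `h`. The grid function `w` is indexed by `ℕ`; only its values at
`0, …, 2 N` enter. -/
noncomputable def gridDiff (N : ℕ) (h w : ℕ → ℝ) (i : ℕ) : ℝ :=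
  ∑ k : Fin (2 * N + 1), stencil h i k * w k

theorem gridDiff_mid {N a : ℕ} (ha : a < N) (h w : ℕ → ℝ) :
    gridDiff N h w (2 * a + 1) = (2 * w (2 * a + 1) - w (2 * a) - w (2 * a + 2)) / h a ^ 2 := by
  unfold gridDiff
  rw [Fin.sum_univ_eq_sum_range (fun k => stencil h (2 * a + 1) k * w k)]
  have e : ∀ k, stencil h (2 * a + 1) k * w k =
      (if k = 2 * a then -(1 / h a ^ 2) * w k else 0)
      + (if k = 2 * a + 1 then 2 / h a ^ 2 * w k else 0)
      + (if k = 2 * a + 2 then -(1 / h a ^ 2) * w k else 0) := by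
    intro k
    have h1 : (2 * a + 1) % 2 = 1 := by omega
    have h2 : (2 * a + 1) / 2 = a := by omega
    simp only [stencil, h1, h2, if_true]
    split_ifs <;> first | omega | ring
  simp only [e, Finset.sum_add_distrib, Finset.sum_ite_eq', Finset.mem_range]
  rw [if_pos (by omega), if_pos (by omega), if_pos (by omega)]
  ring

theorem gridDiff_knot {N a : ℕ} (ha : a + 1 < N) (h w : ℕ → ℝ) :
    gridDiff N h w (2 * a + 2) = 7 * w (2 * a + 2) / (2 * h (a + 1) * h a)
      - (4 * w (2 * a + 3) - w (2 * a + 4) / 2) / (h (a + 1) * (h (a + 1) + h a))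
      - (4 * w (2 * a + 1) - w (2 * a) / 2) / (h a * (h (a + 1) + h a)) := by
  unfold gridDiff
  rw [Fin.sum_univ_eq_sum_range (fun k => stencil h (2 * a + 2) k * w k)]
  have e : ∀ k, stencil h (2 * a + 2) k * w k =
      (if k = 2 * a then 1 / (2 * h a * (h (a + 1) + h a)) * w k else 0)
      + (if k = 2 * a + 1 then -(4 / (h a * (h (a + 1) + h a))) * w k else 0)
      + (if k = 2 * a + 2 then 7 / (2 * h (a + 1) * h a) * w k else 0)
      + (if k = 2 * a + 3 then -(4 / (h (a + 1) * (h (a + 1) + h a))) * w k else 0)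
      + (if k = 2 * a + 4 then 1 / (2 * h (a + 1) * (h (a + 1) + h a)) * w k else 0) := by
    intro k
    have h1 : ¬ (2 * a + 2) % 2 = 1 := by omega
    have h2 : (2 * a + 2) / 2 = a + 1 := by omega
    simp only [stencil, h1, h2, if_false, Nat.add_sub_cancel]
    split_ifs <;> first | omega | ring
  simp only [e, Finset.sum_add_distrib, Finset.sum_ite_eq', Finset.mem_range]
  rw [if_pos (by omega), if_pos (by omega), if_pos (by omega), if_pos (by omega),
    if_pos (by omega)]
  have hq : ∀ s t : ℝ, 1 / (2 * s * t) = 1 / (s * t) / 2 := fun s t => by ring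
  simp only [hq]
  ring

/-- Interior grid points of a one-dimensional grid are midpoints of cells or interior knots. -/
theorem interior_cases {N i : ℕ} (h0 : 0 < i) (h1 : i < 2 * N) :
    (∃ a < N, i = 2 * a + 1) ∨ ∃ a, a + 1 < N ∧ i = 2 * a + 2 := by
  rcases Nat.even_or_odd' i with ⟨c, rfl | rfl⟩
  · exact Or.inr ⟨c - 1, by omega, by omega⟩
  · exact Or.inl ⟨c, by omega, rfl⟩

theorem gridDiff_const {N : ℕ} {h : ℕ → ℝ} (hh : ∀ c < N, 0 < h c) (m : ℝ) {i : ℕ}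
    (h0 : 0 < i) (h1 : i < 2 * N) : gridDiff N h (fun _ => m) i = 0 := by
  rcases interior_cases h0 h1 with ⟨a, ha, rfl⟩ | ⟨a, ha, rfl⟩
  · rw [gridDiff_mid ha]
    ring
  · rw [gridDiff_knot ha]
    have p := hh a (by omega)
    have q := hh (a + 1) ha
    have hs : h (a + 1) + h a ≠ 0 := by positivity
    field_simp
    ring

/-- The coordinate of the `i`-th point of the grid with knots `x`. -/
noncomputable def gridCoord (x : ℕ → ℝ) (i : ℕ) : ℝ := (x (i / 2) + x ((i + 1) / 2)) / 2

/-- The difference operator is exact on quadratic polynomials. -/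
theorem gridDiff_sub_sq {N : ℕ} {x : ℕ → ℝ} (hx : ∀ c < N, 0 < halfLen x c) (m : ℝ) {i : ℕ}
    (h0 : 0 < i) (h1 : i < 2 * N) :
    gridDiff N (halfLen x) (fun k => m - gridCoord x k ^ 2) i = 2 := by
  have hk : ∀ c, gridCoord x (2 * c) = x c := by
    intro c
    rw [gridCoord, show 2 * c / 2 = c by omega, show (2 * c + 1) / 2 = c by omega]
    ring
  have hm : ∀ c, gridCoord x (2 * c + 1) = x c + halfLen x c := by
    intro c
    rw [gridCoord, show (2 * c + 1) / 2 = c by omega, show (2 * c + 1 + 1) / 2 = c + 1 by omega,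
      halfLen]
    ring
  have hs : ∀ c, x (c + 1) = x c + 2 * halfLen x c := by
    intro c
    rw [halfLen]
    ring
  rcases interior_cases h0 h1 with ⟨a, ha, rfl⟩ | ⟨a, ha, rfl⟩
  · have p := hx a ha
    rw [gridDiff_mid ha, hm, hk, show 2 * a + 2 = 2 * (a + 1) by ring, hk, hs]
    field_simp
    ring
  · have p := hx a (by omega)
    have q := hx (a + 1) ha
    have hne : halfLen x (a + 1) + halfLen x a ≠ 0 := by positivity
    rw [gridDiff_knot ha, hm, hk, show 2 * a + 2 = 2 * (a + 1) by ring,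
      show 2 * a + 3 = 2 * (a + 1) + 1 by ring, show 2 * a + 4 = 2 * (a + 1 + 1) by ring, hm, hk,
      hk, hs (a + 1), hs a]
    generalize halfLen x (a + 1) = s at *
    generalize halfLen x a = t at *
    field_simp
    ring

/-! ### Nonnegative strict supersolutions are positive -/

/-- The two-dimensional difference operator replacing `-Δ` at the grid point `(i, j)`. -/
noncomputable def gridLap (N : ℕ) (hx hy : ℕ → ℝ) (V : ℕ → ℕ → ℝ) (i j : ℕ) : ℝ :=
  gridDiff N hx (fun k => V k j) i + gridDiff N hy (V i) j

theorem gridLap_swap (N : ℕ) (hx hy : ℕ → ℝ) (V : ℕ → ℕ → ℝ) (i j : ℕ) :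
    gridLap N hy hx (fun k l => V l k) j i = gridLap N hx hy V i j :=
  add_comm _ _

/-- At a knot the difference operator is bounded by its diagonal part as soon as the values at
the neighbouring midpoints control those at the next knots; the factor `8` is the quotient
`4 / (1 / 2)` of the stencil weights. -/
theorem gridDiff_knot_le {N a : ℕ} (ha : a + 1 < N) {h w : ℕ → ℝ} (hh : ∀ c < N, 0 < h c)
    (hr : w (2 * a + 4) ≤ 8 * w (2 * a + 3)) (hl : w (2 * a) ≤ 8 * w (2 * a + 1)) :
    gridDiff N h w (2 * a + 2) ≤ 7 * w (2 * a + 2) / (2 * h (a + 1) * h a) := by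
  rw [gridDiff_knot ha]
  have p := hh a (by omega)
  have q := hh (a + 1) ha
  have r1 : 0 ≤ (4 * w (2 * a + 3) - w (2 * a + 4) / 2) / (h (a + 1) * (h (a + 1) + h a)) :=
    div_nonneg (by linarith) (by positivity)
  have r2 : 0 ≤ (4 * w (2 * a + 1) - w (2 * a) / 2) / (h a * (h (a + 1) + h a)) :=
    div_nonneg (by linarith) (by positivity)
  linarith

/-- If `(2 s - t) / c + d s ≥ 0`, where the weight `d` is at most `6 / c`, then `t ≤ 8 s`. -/
theorem le_eight_mul_of_nonneg {s t c d : ℝ} (hs : 0 ≤ s) (hc : 0 < c) (hd : d * c ≤ 6)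
    (h : 0 ≤ (2 * s - t) / c + d * s) : t ≤ 8 * s := by
  have h1 : 0 ≤ ((2 * s - t) / c + d * s) * c := mul_nonneg h hc.le
  have h2 : ((2 * s - t) / c + d * s) * c = 2 * s - t + d * c * s := by
    field_simp
  have h3 := mul_le_mul_of_nonneg_right hd hs
  linarith

/-- At a cell center, the value controls those at the adjacent edge centers in `x`-direction. -/
theorem center_bound {N : ℕ} {hx hy : ℕ → ℝ} {V : ℕ → ℕ → ℝ} (hV : ∀ i j, 0 ≤ V i j)
    {a b : ℕ} (ha : a < N) (hb : b < N) (px : 0 < hx a) (py : 0 < hy b)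
    (hab : hx a ^ 2 ≤ 3 * hy b ^ 2) (hL : 0 ≤ gridLap N hx hy V (2 * a + 1) (2 * b + 1)) :
    V (2 * a) (2 * b + 1) ≤ 8 * V (2 * a + 1) (2 * b + 1) ∧
      V (2 * a + 2) (2 * b + 1) ≤ 8 * V (2 * a + 1) (2 * b + 1) := by
  rw [gridLap, gridDiff_mid ha, gridDiff_mid hb] at hL
  have hd : 2 / hy b ^ 2 * hx a ^ 2 ≤ 6 := by
    rw [div_mul_eq_mul_div, div_le_iff₀ (by positivity)]
    linarith
  have hy' : (2 * V (2 * a + 1) (2 * b + 1) - V (2 * a + 1) (2 * b) - V (2 * a + 1) (2 * b + 2))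
      / hy b ^ 2 ≤ 2 / hy b ^ 2 * V (2 * a + 1) (2 * b + 1) := by
    rw [div_mul_eq_mul_div]
    gcongr
    linarith [hV (2 * a + 1) (2 * b), hV (2 * a + 1) (2 * b + 2)]
  constructor
  · refine le_eight_mul_of_nonneg (hV _ _) (pow_pos px 2) hd
      ((hL.trans (add_le_add_right hy' _)).trans (add_le_add_left ?_ _))
    exact div_le_div_of_nonneg_right (by linarith [hV (2 * a + 2) (2 * b + 1)]) (sq_nonneg _)
  · refine le_eight_mul_of_nonneg (hV _ _) (pow_pos px 2) hd
      ((hL.trans (add_le_add_right hy' _)).trans (add_le_add_left ?_ _))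
    exact div_le_div_of_nonneg_right (by linarith [hV (2 * a) (2 * b + 1)]) (sq_nonneg _)

/-- At the center of an edge parallel to the `x`-axis, the value controls those at the end points
of the edge. -/
theorem edge_bound {N : ℕ} {hx hy : ℕ → ℝ} {V : ℕ → ℕ → ℝ} (hV : ∀ i j, 0 ≤ V i j)
    (px : ∀ c < N, 0 < hx c) (py : ∀ c < N, 0 < hy c)
    {a b : ℕ} (ha : a < N) (hb : b + 1 < N)
    (hyx : ∀ c < N, hy c ^ 2 ≤ 3 * hx a ^ 2) (hxy : 7 * hx a ^ 2 ≤ 12 * (hy (b + 1) * hy b))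
    (hL : ∀ i j, 0 < i → i < 2 * N → 0 < j → j < 2 * N → 0 ≤ gridLap N hx hy V i j) :
    V (2 * a) (2 * b + 2) ≤ 8 * V (2 * a + 1) (2 * b + 2) ∧
      V (2 * a + 2) (2 * b + 2) ≤ 8 * V (2 * a + 1) (2 * b + 2) := by
  have hc : ∀ c < N, V (2 * a + 1) (2 * c) ≤ 8 * V (2 * a + 1) (2 * c + 1) ∧
      V (2 * a + 1) (2 * c + 2) ≤ 8 * V (2 * a + 1) (2 * c + 1) := fun c hc =>
    center_bound (V := fun k l => V l k) (fun i j => hV j i) hc ha (py c hc) (px a ha) (hyx c hc)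
      (by rw [gridLap_swap]; exact hL _ _ (by omega) (by omega) (by omega) (by omega))
  have hk := gridDiff_knot_le hb py (w := V (2 * a + 1)) (hc (b + 1) hb).2 (hc b (by omega)).1
  have hL' := hL (2 * a + 1) (2 * b + 2) (by omega) (by omega) (by omega) (by omega)
  rw [gridLap, gridDiff_mid ha] at hL'
  have pa := px a ha
  have pb := py b (by omega)
  have pb' := py (b + 1) hb
  rw [mul_div_right_comm] at hk
  have hd : 7 / (2 * hy (b + 1) * hy b) * hx a ^ 2 ≤ 6 := by
    rw [div_mul_eq_mul_div, div_le_iff₀ (by positivity)]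
    linarith
  constructor
  · refine le_eight_mul_of_nonneg (hV _ _) (pow_pos pa 2) hd
      ((hL'.trans (add_le_add_right hk _)).trans (add_le_add_left ?_ _))
    exact div_le_div_of_nonneg_right (by linarith [hV (2 * a + 2) (2 * b + 2)]) (sq_nonneg _)
  · refine le_eight_mul_of_nonneg (hV _ _) (pow_pos pa 2) hd
      ((hL'.trans (add_le_add_right hk _)).trans (add_le_add_left ?_ _))
    exact div_le_div_of_nonneg_right (by linarith [hV (2 * a) (2 * b + 2)]) (sq_nonneg _)

/-- The mesh constraints in the form in which they are used: two conditions on a pair of mesh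
intervals in `x` and `y`, and two on a mesh interval in one direction and a pair of adjacent ones
in the other direction. They hold for all mesh intervals since each of them, if there are at least
two, has an interior knot as an end point. -/
structure MeshBounds (N : ℕ) (hx hy : ℕ → ℝ) : Prop where
  sq_le : 1 < N → ∀ a < N, ∀ b < N, hx a ^ 2 ≤ 3 * hy b ^ 2
  sq_ge : 1 < N → ∀ a < N, ∀ b < N, hy b ^ 2 ≤ 3 * hx a ^ 2
  sq_le_mul : ∀ a < N, ∀ b, b + 1 < N → 7 * hx a ^ 2 ≤ 12 * (hy (b + 1) * hy b)
  sq_ge_mul : ∀ b < N, ∀ a, a + 1 < N → 7 * hy b ^ 2 ≤ 12 * (hx (a + 1) * hx a)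

theorem LocalConstraint.bounds {p' p q' q : ℝ} (h : LocalConstraint p' p q' q) (hp' : 0 < p')
    (hp : 0 < p) (hq' : 0 < q') (hq : 0 < q) :
    (∀ s, s = p' ∨ s = p → 7 * s ^ 2 ≤ 12 * (q * q') ∧
      ∀ t, t = q' ∨ t = q → s ^ 2 ≤ 3 * t ^ 2 ∧ t ^ 2 ≤ 3 * s ^ 2) ∧
    ∀ t, t = q' ∨ t = q → 7 * t ^ 2 ≤ 12 * (p * p') := by
  obtain ⟨h1, h2, h3, h4⟩ := h
  have key : ∀ s t : ℝ, 0 < s → √(1 / 3) * s ≤ t → s ^ 2 ≤ 3 * t ^ 2 := by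
    intro s t hs hst
    have h5 := pow_le_pow_left₀ (by positivity) hst 2
    rw [mul_pow, Real.sq_sqrt (by norm_num)] at h5
    linarith
  have hr : 0 ≤ √(1 / 3 : ℝ) := Real.sqrt_nonneg _
  have hmp2 : p' ^ 2 ≤ max (p ^ 2) (p' ^ 2) ∧ p ^ 2 ≤ max (p ^ 2) (p' ^ 2) :=
    ⟨le_max_right _ _, le_max_left _ _⟩
  have hmq2 : q' ^ 2 ≤ max (q ^ 2) (q' ^ 2) ∧ q ^ 2 ≤ max (q ^ 2) (q' ^ 2) :=
    ⟨le_max_right _ _, le_max_left _ _⟩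
  refine ⟨fun s hs => ⟨?_, fun t ht => ⟨key s t ?_ ?_, key t s ?_ ?_⟩⟩, fun t ht => ?_⟩
  · rcases hs with rfl | rfl <;> linarith [hmp2.1, hmp2.2]
  · rcases hs with rfl | rfl <;> assumption
  · refine (mul_le_mul_of_nonneg_left ?_ hr).trans (h4.trans ?_)
    · rcases hs with rfl | rfl <;> simp
    · rcases ht with rfl | rfl <;> simp
  · rcases ht with rfl | rfl <;> assumption
  · refine (mul_le_mul_of_nonneg_left ?_ hr).trans (h3.trans ?_)
    · rcases ht with rfl | rfl <;> simp
    · rcases hs with rfl | rfl <;> simp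
  · rcases ht with rfl | rfl <;> linarith [hmq2.1, hmq2.2]

theorem MeshConstraint.meshBounds {N : ℕ} {x y : ℕ → ℝ} (h : MeshConstraint N x y)
    (px : ∀ c < N, 0 < halfLen x c) (py : ∀ c < N, 0 < halfLen y c) :
    MeshBounds N (halfLen x) (halfLen y) := by
  have hloc : ∀ a b, a + 1 < N → b + 1 < N → _ := fun a b ha hb =>
    (h (a + 1) (b + 1) (by omega) ha (by omega) hb).bounds
      (px a (by omega)) (px _ ha) (py b (by omega)) (py _ hb)
  -- Every mesh interval has an interior knot as an end point when there are at least two.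
  have hend : ∀ a < N, 1 < N → ∃ c, c + 1 < N ∧ (a = c ∨ a = c + 1) := fun a ha hN => by
    rcases Nat.eq_zero_or_pos a with rfl | h0
    · exact ⟨0, by omega, Or.inl rfl⟩
    · exact ⟨a - 1, by omega, Or.inr (by omega)⟩
  have hor : ∀ (z : ℕ → ℝ) {a c : ℕ}, (a = c ∨ a = c + 1) →
      (halfLen z a = halfLen z c ∨ halfLen z a = halfLen z (c + 1)) := by
    rintro z a c (rfl | rfl) <;> simp
  have hpair : 1 < N → ∀ a < N, ∀ b < N, halfLen x a ^ 2 ≤ 3 * halfLen y b ^ 2 ∧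
      halfLen y b ^ 2 ≤ 3 * halfLen x a ^ 2 := fun hN a ha b hb => by
    obtain ⟨c, hc, hac⟩ := hend a ha hN
    obtain ⟨d, hd, hbd⟩ := hend b hb hN
    exact ((hloc c d hc hd).1 _ (hor x hac)).2 _ (hor y hbd)
  refine ⟨fun hN a ha b hb => (hpair hN a ha b hb).1, fun hN a ha b hb => (hpair hN a ha b hb).2,
    fun a ha b hb => ?_, fun b hb a ha => ?_⟩
  · obtain ⟨c, hc, hac⟩ := hend a ha (by omega)
    exact ((hloc c b hc hb).1 _ (hor x hac)).1
  · obtain ⟨d, hd, hbd⟩ := hend b hb (by omega)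
    exact (hloc a d ha hd).2 _ (hor y hbd)

/-- A nonnegative grid function with positive discrete `-Δ` vanishes at no interior point: at a
zero, the positive stencil entries are outweighed by the negative ones. -/
theorem pos_of_gridLap_pos {N : ℕ} {hx hy : ℕ → ℝ} {V : ℕ → ℕ → ℝ} (hV : ∀ i j, 0 ≤ V i j)
    (px : ∀ c < N, 0 < hx c) (py : ∀ c < N, 0 < hy c) (hb : MeshBounds N hx hy)
    (hL : ∀ i j, 0 < i → i < 2 * N → 0 < j → j < 2 * N → 0 < gridLap N hx hy V i j)
    {i j : ℕ} (hi0 : 0 < i) (hi : i < 2 * N) (hj0 : 0 < j) (hj : j < 2 * N) : 0 < V i j := by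
  refine (hV i j).lt_of_ne fun h0 => ?_
  have hp := hL i j hi0 hi hj0 hj
  have hLn : ∀ i j, 0 < i → i < 2 * N → 0 < j → j < 2 * N → 0 ≤ gridLap N hx hy V i j :=
    fun i j h1 h2 h3 h4 => (hL i j h1 h2 h3 h4).le
  have hLs : ∀ j i, 0 < j → j < 2 * N → 0 < i → i < 2 * N →
      0 ≤ gridLap N hy hx (fun k l => V l k) j i := fun j i h1 h2 h3 h4 => by
    rw [gridLap_swap]
    exact hLn i j h3 h4 h1 h2
  have hmid : ∀ {h w : ℕ → ℝ} {c : ℕ}, c < N → (∀ k, 0 ≤ w k) → w (2 * c + 1) = 0 →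
      gridDiff N h w (2 * c + 1) ≤ 0 := fun {h w c} hc hw h0 => by
    rw [gridDiff_mid hc, h0]
    exact div_nonpos_of_nonpos_of_nonneg
      (by linarith [hw (2 * c), hw (2 * c + 2)]) (by positivity)
  have hknot : ∀ {h w : ℕ → ℝ} {c : ℕ}, c + 1 < N → (∀ c < N, 0 < h c) → w (2 * c + 2) = 0 →
      w (2 * c + 4) ≤ 8 * w (2 * c + 3) → w (2 * c) ≤ 8 * w (2 * c + 1) →
      gridDiff N h w (2 * c + 2) ≤ 0 := fun hc hh h0 h1 h2 => by
    simpa [h0] using gridDiff_knot_le hc hh h1 h2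
  -- In the lines through midpoints of the orthogonal direction the bound comes from the cell
  -- centers, in the lines through knots from the edge centers.
  have hX : gridDiff N hx (fun k => V k j) i ≤ 0 := by
    rcases interior_cases hi0 hi with ⟨a, ha, rfl⟩ | ⟨a, ha, rfl⟩
    · exact hmid ha (fun k => hV k j) h0.symm
    · have hbd : ∀ c < N, V (2 * c) j ≤ 8 * V (2 * c + 1) j ∧
          V (2 * c + 2) j ≤ 8 * V (2 * c + 1) j := fun c hc => by
        rcases interior_cases hj0 hj with ⟨b, hb', rfl⟩ | ⟨b, hb', rfl⟩
        · exact center_bound hV hc hb' (px c hc) (py b hb') (hb.sq_le (by omega) c hc b hb')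
            (hLn _ _ (by omega) (by omega) hj0 hj)
        · exact edge_bound hV px py hc hb' (hb.sq_ge (by omega) c hc)
            (hb.sq_le_mul c hc b hb') hLn
      exact hknot ha px h0.symm (hbd (a + 1) ha).2 (hbd a (by omega)).1
  have hY : gridDiff N hy (V i) j ≤ 0 := by
    rcases interior_cases hj0 hj with ⟨b, hb', rfl⟩ | ⟨b, hb', rfl⟩
    · exact hmid hb' (hV i) h0.symm
    · have hbd : ∀ c < N, V i (2 * c) ≤ 8 * V i (2 * c + 1) ∧
          V i (2 * c + 2) ≤ 8 * V i (2 * c + 1) := fun c hc => by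
        rcases interior_cases hi0 hi with ⟨a, ha, rfl⟩ | ⟨a, ha, rfl⟩
        · exact center_bound (V := fun k l => V l k) (fun i j => hV j i) hc ha (py c hc) (px a ha)
            (hb.sq_ge (by omega) a ha c hc) (hLs _ _ (by omega) (by omega) hi0 hi)
        · exact edge_bound (V := fun k l => V l k) (fun i j => hV j i) py px hc ha
            (fun d hd => hb.sq_le (by omega) d hd c hc) (hb.sq_ge_mul c hc a ha) hLs
      exact hknot hb' py h0.symm (hbd (b + 1) hb').2 (hbd b (by omega)).1
  rw [gridLap] at hp
  linarith

/-! ### Monotonicity and the discrete maximum principle -/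

/-- A grid function as a function of two natural numbers, extended by zero. -/
noncomputable def gridExt {N : ℕ} (u : Grid N → ℝ) (i j : ℕ) : ℝ :=
  if h : i < 2 * N + 1 ∧ j < 2 * N + 1 then u (⟨i, h.1⟩, ⟨j, h.2⟩) else 0

theorem gridExt_apply {N : ℕ} (u : Grid N → ℝ) (p : Grid N) :
    gridExt u p.1 p.2 = u p := by
  rw [gridExt, dif_pos ⟨p.1.2, p.2.2⟩]

theorem gridExt_nonneg {N : ℕ} {u : Grid N → ℝ} (hu : ∀ p, 0 ≤ u p) (i j : ℕ) :
    0 ≤ gridExt u i j := by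
  unfold gridExt
  split_ifs
  exacts [hu _, le_rfl]

theorem not_isBoundary_iff {N : ℕ} {p : Grid N} : ¬ IsBoundary p ↔
    (0 < (p.1 : ℕ) ∧ (p.1 : ℕ) < 2 * N) ∧ 0 < (p.2 : ℕ) ∧ (p.2 : ℕ) < 2 * N := by
  have h1 := p.1.2
  have h2 := p.2.2
  unfold IsBoundary
  omega

theorem fullMatrix_mulVec_of_isBoundary {N : ℕ} {x y : ℕ → ℝ} {u : Grid N → ℝ} {p : Grid N}
    (hp : IsBoundary p) : (fullMatrix N x y *ᵥ u) p = u p := by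
  simp [Matrix.mulVec, dotProduct, fullMatrix, hp]

theorem fullMatrix_mulVec_of_not_isBoundary {N : ℕ} {x y : ℕ → ℝ} {u : Grid N → ℝ}
    {U : ℕ → ℕ → ℝ} (hU : ∀ p : Grid N, U p.1 p.2 = u p) {p : Grid N} (hp : ¬ IsBoundary p) :
    (fullMatrix N x y *ᵥ u) p = gridLap N (halfLen x) (halfLen y) U p.1 p.2 := by
  have hU' : ∀ k l : Fin (2 * N + 1), U k l = u (k, l) := fun k l => hU (k, l)
  simp only [Matrix.mulVec, dotProduct, fullMatrix, Matrix.of_apply, if_neg hp, add_mul,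
    Finset.sum_add_distrib, gridLap, gridDiff, hU', Fintype.sum_prod_type, ite_mul, zero_mul]
  congr 1
  · simp
  · rw [Finset.sum_comm]
    simp

theorem fullMatrix_mulVec_const {N : ℕ} {x y : ℕ → ℝ} (px : ∀ c < N, 0 < halfLen x c)
    (py : ∀ c < N, 0 < halfLen y c) (m : ℝ) {p : Grid N} (hp : ¬ IsBoundary p) :
    (fullMatrix N x y *ᵥ fun _ => m) p = 0 := by
  rw [fullMatrix_mulVec_of_not_isBoundary (U := fun _ _ => m) (fun _ => rfl) hp]
  obtain ⟨⟨h1, h2⟩, h3, h4⟩ := not_isBoundary_iff.1 hp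
  rw [gridLap, gridDiff_const px m h1 h2, gridDiff_const py m h3 h4, add_zero]

/-- The function `m - x²`, with `m` large, is a positive strict supersolution. -/
theorem exists_pos_mulVec_pos {N : ℕ} {x : ℕ → ℝ} (y : ℕ → ℝ) (px : ∀ c < N, 0 < halfLen x c)
    (py : ∀ c < N, 0 < halfLen y c) :
    ∃ w : Grid N → ℝ, (∀ p, 0 < w p) ∧ ∀ p, 0 < (fullMatrix N x y *ᵥ w) p := by
  set m : ℝ := 1 + ∑ i : Fin (2 * N + 1), gridCoord x i ^ 2 with hm
  have hw : ∀ p : Grid N, 0 < m - gridCoord x p.1 ^ 2 := fun p => by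
    have h := Finset.single_le_sum (f := fun i : Fin (2 * N + 1) => gridCoord x i ^ 2)
      (fun _ _ => sq_nonneg _) (Finset.mem_univ p.1)
    linarith
  refine ⟨fun p => m - gridCoord x p.1 ^ 2, hw, fun p => ?_⟩
  by_cases hp : IsBoundary p
  · rw [fullMatrix_mulVec_of_isBoundary hp]
    exact hw p
  · rw [fullMatrix_mulVec_of_not_isBoundary (U := fun i _ => m - gridCoord x i ^ 2)
      (fun _ => rfl) hp]
    obtain ⟨⟨h1, h2⟩, h3, h4⟩ := not_isBoundary_iff.1 hp
    rw [gridLap, gridDiff_sub_sq px m h1 h2, gridDiff_const py _ h3 h4]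
    norm_num

/-- Inverse positivity: if `L̄_h u ≥ 0` then `u ≥ 0`. Otherwise, subtracting a multiple of a
positive strict supersolution from `u` would give a nonnegative strict supersolution with a
zero. -/
theorem nonneg_of_mulVec_nonneg {N : ℕ} {x y : ℕ → ℝ} (px : ∀ c < N, 0 < halfLen x c)
    (py : ∀ c < N, 0 < halfLen y c) (hb : MeshBounds N (halfLen x) (halfLen y))
    {u : Grid N → ℝ} (hu : ∀ p, 0 ≤ (fullMatrix N x y *ᵥ u) p) (p : Grid N) : 0 ≤ u p := by
  obtain ⟨w, hw, hLw⟩ := exists_pos_mulVec_pos y px py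
  obtain ⟨q, hq⟩ := Finite.exists_min fun p => u p / w p
  set t := u q / w q with ht
  rcases le_or_gt 0 t with h0 | h0
  · have h := h0.trans (hq p)
    rwa [le_div_iff₀ (hw p), zero_mul] at h
  exfalso
  have hv : ∀ p, 0 ≤ (u - t • w) p := fun p => by
    have h := (le_div_iff₀ (hw p)).1 (hq p)
    simpa using h
  have hvq : (u - t • w) q = 0 := by
    simp [ht, div_mul_cancel₀ _ (hw q).ne']
  have hLv : ∀ p, 0 < (fullMatrix N x y *ᵥ (u - t • w)) p := fun p => by
    rw [mulVec_sub, mulVec_smul, Pi.sub_apply, Pi.smul_apply, smul_eq_mul]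
    linarith [hu p, mul_neg_of_neg_of_pos h0 (hLw p)]
  by_cases hqb : IsBoundary q
  · have h := hLv q
    rw [fullMatrix_mulVec_of_isBoundary hqb, hvq] at h
    exact h.false
  · obtain ⟨⟨h1, h2⟩, h3, h4⟩ := not_isBoundary_iff.1 hqb
    have h := pos_of_gridLap_pos (gridExt_nonneg hv) px py hb (fun i j hi0 hi hj0 hj => by
      have hp := hLv (⟨i, by omega⟩, ⟨j, by omega⟩)
      rwa [fullMatrix_mulVec_of_not_isBoundary (gridExt_apply _)
        (not_isBoundary_iff.2 ⟨⟨hi0, hi⟩, hj0, hj⟩)] at hp) h1 h2 h3 h4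
    rw [gridExt_apply, hvq] at h
    exact h.false

theorem isMonotone_of_nonneg {ι : Type*} [Fintype ι] [DecidableEq ι] {A : Matrix ι ι ℝ}
    (hA : ∀ u : ι → ℝ, (∀ p, 0 ≤ (A *ᵥ u) p) → ∀ p, 0 ≤ u p) : IsMonotone A := by
  have hunit : IsUnit A := by
    rw [← Matrix.mulVec_injective_iff_isUnit]
    intro u v huv
    have huv' : A *ᵥ u = A *ᵥ v := huv
    ext p
    apply le_antisymm
    · have h := hA (v - u) (fun p => by rw [mulVec_sub, huv', sub_self]; exact le_rfl) p
      rwa [Pi.sub_apply, sub_nonneg] at h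
    · have h := hA (u - v) (fun p => by rw [mulVec_sub, huv', sub_self]; exact le_rfl) p
      rwa [Pi.sub_apply, sub_nonneg] at h
  refine ⟨hunit, fun p q => ?_⟩
  have h := hA (A⁻¹ *ᵥ Pi.single q 1) (fun r => by
    rw [mulVec_mulVec, Matrix.mul_nonsing_inv _ ((Matrix.isUnit_iff_isUnit_det A).1 hunit),
      one_mulVec]
    exact (Pi.single_nonneg.2 zero_le_one : (0 : ι → ℝ) ≤ Pi.single q 1) r) p
  simpa using h

theorem discreteMaxPrinciple_fullMatrix {N : ℕ} {x y : ℕ → ℝ} (px : ∀ c < N, 0 < halfLen x c)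
    (py : ∀ c < N, 0 < halfLen y c) (hb : MeshBounds N (halfLen x) (halfLen y)) :
    DiscreteMaxPrinciple (fullMatrix N x y) := by
  intro u hu p _
  set m := max 0 (⨆ q : {q : Grid N // IsBoundary q}, u q) with hm
  have h := nonneg_of_mulVec_nonneg px py hb (u := (fun _ => m) - u) (fun q => ?_) p
  · rwa [Pi.sub_apply, sub_nonneg] at h
  by_cases hq : IsBoundary q
  · rw [fullMatrix_mulVec_of_isBoundary hq, Pi.sub_apply, sub_nonneg]
    exact (le_ciSup (f := fun q : {q : Grid N // IsBoundary q} => u q)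
      (Set.finite_range _).bddAbove ⟨q, hq⟩).trans (le_max_right _ _)
  · rw [mulVec_sub, Pi.sub_apply, fullMatrix_mulVec_const px py m hq, sub_nonneg]
    exact hu q hq

/-! ### Equivalence with the variational form -/

theorem glNode_injective : Function.Injective glNode := by
  intro i j h
  fin_cases i <;> fin_cases j <;> first | rfl | (norm_num [glNode] at h)

theorem eval_basisPoly (r k : Fin 3) :
    (basisPoly r).eval (glNode k) = if r = k then 1 else 0 := by
  split_ifs with h
  · subst h
    exact Lagrange.eval_basis_self glNode_injective.injOn (Finset.mem_univ _)
  · exact Lagrange.eval_basis_of_ne h (Finset.mem_univ _)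

/-- The values at the node `k` of the derivatives of the basis polynomials. -/
theorem eval_derivative_basisPoly (r k : Fin 3) :
    (basisPoly r).derivative.eval (glNode k) =
      !![-3 / 2, 2, -1 / 2; -1 / 2, 0, 1 / 2; 1 / 2, -2, 3 / 2] k r := by
  have e0 : (Finset.univ : Finset (Fin 3)).erase 0 = {1, 2} := by decide
  have e1 : (Finset.univ : Finset (Fin 3)).erase 1 = {0, 2} := by decide
  have e2 : (Finset.univ : Finset (Fin 3)).erase 2 = {0, 1} := by decide
  fin_cases r <;> fin_cases k <;>
    simp [basisPoly, Lagrange.basis, Lagrange.basisDivisor, e0, e1, e2, glNode] <;> norm_num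

theorem glWeight_pos (k : Fin 3) : 0 < glWeight k := by
  fin_cases k <;> norm_num [glWeight]

/-- Summation by parts for the one-dimensional scheme: the quadrature of `U' V'` equals that of
the difference quotient of `U` times `V`. The midpoint terms agree cell by cell; the difference of
the knot terms telescopes. -/
theorem sum_deriv_mul_deriv {N : ℕ} {h : ℕ → ℝ} (hh : ∀ c < N, 0 < h c) (U V : ℕ → ℝ)
    (hV0 : V 0 = 0) (hVN : V (2 * N) = 0) :
    ∑ a : Fin N, ∑ k : Fin 3, (h a * glWeight k) *
      ((∑ r : Fin 3, U (2 * a + r) * ((basisPoly r).derivative.eval (glNode k) / h a)) *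
        ∑ r : Fin 3, V (2 * a + r) * ((basisPoly r).derivative.eval (glNode k) / h a)) =
    ∑ a : Fin N, ∑ k : Fin 3, (h a * glWeight k) *
      (gridDiff N h U (2 * a + k) * V (2 * a + k)) := by
  -- The coefficient of `V (2 a)` in the difference of the two sums over the cell `a`.
  set G : ℕ → ℝ := fun a => ((7 * U (2 * a) - 8 * U (2 * a + 1) + U (2 * a + 2)) / (6 * h a)
    - h a / 3 * gridDiff N h U (2 * a)) * V (2 * a) with hG
  rw [← sub_eq_zero, ← Finset.sum_sub_distrib]
  trans ∑ a : Fin N, (G a - G (a + 1))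
  swap
  · rw [Fin.sum_univ_eq_sum_range (fun c => G c - G (c + 1)), Finset.sum_range_sub']
    simp [hG, hV0, hVN]
  refine Finset.sum_congr rfl fun ⟨a, ha⟩ _ => ?_
  have p := hh a ha
  simp only [hG, Fin.sum_univ_three, eval_derivative_basisPoly, glWeight, Fin.isValue,
    Matrix.of_apply, Matrix.cons_val, Fin.val_zero, Fin.val_one, Fin.val_two, add_zero,
    gridDiff_mid ha, show 2 * (a + 1) = 2 * a + 2 by ring, show 2 * a + 2 + 1 = 2 * a + 3 by ring,
    show 2 * a + 2 + 2 = 2 * a + 4 by ring]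
  rcases Nat.lt_or_ge (a + 1) N with h1 | h1
  · rw [gridDiff_knot h1]
    have q := hh (a + 1) h1
    have hs : h (a + 1) + h a ≠ 0 := by positivity
    generalize h (a + 1) = s at *
    generalize h a = t at *
    field_simp
    ring
  · obtain rfl : N = a + 1 := by omega
    have hV2 : V (2 * a + 2) = 0 := hVN
    rw [hV2]
    field_simp
    ring

/-- The stiffness form with quadrature is the quadrature product with the matrix of the scheme. -/
theorem formA_eq_quadProd {N : ℕ} {x y : ℕ → ℝ} (px : ∀ c < N, 0 < halfLen x c)
    (py : ∀ c < N, 0 < halfLen y c) (u v : Grid N → ℝ) (hv : ∀ p, IsBoundary p → v p = 0) :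
    formA N x y u v = quadProd N x y (fullMatrix N x y *ᵥ u) v := by
  have hc : ∀ (w : Grid N → ℝ) (a b : Fin N) (r s : Fin 3),
      w (cellPoint a b r s) = gridExt w (2 * a + r) (2 * b + s) :=
    fun w a b r s => (gridExt_apply w (cellPoint a b r s)).symm
  have hX : ∀ (w : Grid N → ℝ) (a b : Fin N) (k l : Fin 3), dX x w a b k l =
      ∑ r : Fin 3, gridExt w (2 * a + r) (2 * b + l) *
        ((basisPoly r).derivative.eval (glNode k) / halfLen x a) := fun w a b k l => by
    simp [dX, eval_basisPoly, hc]
  have hY : ∀ (w : Grid N → ℝ) (a b : Fin N) (k l : Fin 3), dY y w a b k l =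
      ∑ s : Fin 3, gridExt w (2 * a + k) (2 * b + s) *
        ((basisPoly s).derivative.eval (glNode l) / halfLen y b) := fun w a b k l => by
    simp [dY, eval_basisPoly, hc]
  have hv0 : ∀ p : Grid N, IsBoundary p → gridExt v p.1 p.2 = 0 := fun p hp => by
    rw [gridExt_apply, hv p hp]
  have hR : ∀ (a b : Fin N) (k l : Fin 3),
      (fullMatrix N x y *ᵥ u) (cellPoint a b k l) * v (cellPoint a b k l) =
        gridDiff N (halfLen x) (fun i => gridExt u i (2 * b + l)) (2 * a + k)
            * gridExt v (2 * a + k) (2 * b + l)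
          + gridDiff N (halfLen y) (gridExt u (2 * a + k)) (2 * b + l)
            * gridExt v (2 * a + k) (2 * b + l) := fun a b k l => by
    rw [← hc v]
    by_cases hp : IsBoundary (cellPoint a b k l)
    · simp [hv _ hp]
    · rw [fullMatrix_mulVec_of_not_isBoundary (gridExt_apply u) hp, gridLap, add_mul]
      rfl
  have hswap : ∀ f : Fin N → Fin N → Fin 3 → Fin 3 → ℝ,
      ∑ a, ∑ b, ∑ k, ∑ l, f a b k l = ∑ b, ∑ l, ∑ a, ∑ k, f a b k l := fun f => by
    rw [Finset.sum_comm]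
    refine Finset.sum_congr rfl fun b _ => ?_
    exact (Finset.sum_congr rfl fun a _ => Finset.sum_comm).trans Finset.sum_comm
  have hswap' : ∀ f : Fin N → Fin N → Fin 3 → Fin 3 → ℝ,
      ∑ a, ∑ b, ∑ k, ∑ l, f a b k l = ∑ a, ∑ k, ∑ b, ∑ l, f a b k l := fun f =>
    Finset.sum_congr rfl fun a _ => Finset.sum_comm
  simp only [formA, quadProd, hR, mul_add, Finset.sum_add_distrib]
  congr 1
  · rw [hswap, hswap]
    refine Finset.sum_congr rfl fun b _ => Finset.sum_congr rfl fun l _ => ?_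
    have h := sum_deriv_mul_deriv px (fun i => gridExt u i (2 * b + l))
      (fun i => gridExt v i (2 * b + l))
      (hv0 (⟨0, by omega⟩, ⟨2 * b + l, by omega⟩) (Or.inl rfl))
      (hv0 (⟨2 * N, by omega⟩, ⟨2 * b + l, by omega⟩) (Or.inr (Or.inl rfl)))
    simp only [hX, mul_right_comm _ (halfLen y b * glWeight l), ← Finset.sum_mul]
    rw [h]
  · rw [hswap', hswap']
    refine Finset.sum_congr rfl fun a _ => Finset.sum_congr rfl fun k _ => ?_
    have h := sum_deriv_mul_deriv py (gridExt u (2 * a + k)) (gridExt v (2 * a + k))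
      (hv0 (⟨2 * a + k, by omega⟩, ⟨0, by omega⟩) (Or.inr (Or.inr (Or.inl rfl))))
      (hv0 (⟨2 * a + k, by omega⟩, ⟨2 * N, by omega⟩) (Or.inr (Or.inr (Or.inr rfl))))
    simp only [hY, mul_assoc (halfLen x a * glWeight k), ← Finset.mul_sum]
    rw [h]

theorem exists_cellPoint_eq {N : ℕ} (hN : 1 ≤ N) (p : Grid N) :
    ∃ a b r s, cellPoint a b r s = p := by
  have key : ∀ i : Fin (2 * N + 1), ∃ (a : Fin N) (r : Fin 3), 2 * (a : ℕ) + r = i := fun i => by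
    have hi := i.2
    by_cases h : (i : ℕ) = 2 * N
    · exact ⟨⟨N - 1, by omega⟩, ⟨2, by omega⟩, by simp only; omega⟩
    · exact ⟨⟨i / 2, by omega⟩, ⟨i % 2, by omega⟩, by simp only; omega⟩
  obtain ⟨a, r, h1⟩ := key p.1
  obtain ⟨b, s, h2⟩ := key p.2
  exact ⟨a, b, r, s, Prod.ext (Fin.ext h1) (Fin.ext h2)⟩

theorem eq_zero_of_quadProd_self {N : ℕ} (hN : 1 ≤ N) {x y : ℕ → ℝ}
    (px : ∀ c < N, 0 < halfLen x c) (py : ∀ c < N, 0 < halfLen y c) {g : Grid N → ℝ}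
    (hg : quadProd N x y g g = 0) : g = 0 := by
  have hW : ∀ (a b : Fin N) (k l : Fin 3),
      0 < (halfLen x a * glWeight k) * (halfLen y b * glWeight l) := fun a b k l =>
    mul_pos (mul_pos (px a a.2) (glWeight_pos k)) (mul_pos (py b b.2) (glWeight_pos l))
  have hnn : ∀ (a b : Fin N) (k l : Fin 3),
      0 ≤ (halfLen x a * glWeight k) * (halfLen y b * glWeight l)
        * (g (cellPoint a b k l) * g (cellPoint a b k l)) := fun a b k l =>
    mul_nonneg (hW a b k l).le (mul_self_nonneg _)
  ext p
  obtain ⟨a, b, k, l, rfl⟩ := exists_cellPoint_eq hN p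
  have h1 := (Finset.sum_eq_zero_iff_of_nonneg fun a _ => Finset.sum_nonneg fun b _ =>
    Finset.sum_nonneg fun k _ => Finset.sum_nonneg fun l _ => hnn a b k l).1 hg a
    (Finset.mem_univ _)
  have h2 := (Finset.sum_eq_zero_iff_of_nonneg fun b _ =>
    Finset.sum_nonneg fun k _ => Finset.sum_nonneg fun l _ => hnn a b k l).1 h1 b
    (Finset.mem_univ _)
  have h3 := (Finset.sum_eq_zero_iff_of_nonneg fun k _ =>
    Finset.sum_nonneg fun l _ => hnn a b k l).1 h2 k (Finset.mem_univ _)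
  have h4 := (Finset.sum_eq_zero_iff_of_nonneg fun l _ => hnn a b k l).1 h3 l (Finset.mem_univ _)
  exact mul_self_eq_zero.1 ((mul_eq_zero.1 h4).resolve_left (hW a b k l).ne')

/-- For the converse direction, the residual itself is used as a test function. -/
theorem mulVec_eq_iff_isVariationalSolution {N : ℕ} (hN : 1 ≤ N) {x y : ℕ → ℝ}
    (px : ∀ c < N, 0 < halfLen x c) (py : ∀ c < N, 0 < halfLen y c) (u f : Grid N → ℝ) :
    fullMatrix N x y *ᵥ u = f ↔ IsVariationalSolution N x y u f := by
  constructor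
  · rintro rfl
    exact ⟨fun p hp => (fullMatrix_mulVec_of_isBoundary hp).symm,
      fun v hv => formA_eq_quadProd px py u v hv⟩
  · rintro ⟨hb, hvar⟩
    have hres : ∀ p, IsBoundary p → (fullMatrix N x y *ᵥ u - f) p = 0 := fun p hp => by
      rw [Pi.sub_apply, fullMatrix_mulVec_of_isBoundary hp, hb p hp, sub_self]
    have h := hvar _ hres
    rw [formA_eq_quadProd px py u _ hres] at h
    refine sub_eq_zero.1 (eq_zero_of_quadProd_self hN px py ?_)
    refine Eq.trans ?_ (sub_eq_zero.2 h)
    simp only [quadProd, ← Finset.sum_sub_distrib, Pi.sub_apply]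
    refine Finset.sum_congr rfl fun a _ => Finset.sum_congr rfl fun b _ =>
      Finset.sum_congr rfl fun k _ => Finset.sum_congr rfl fun l _ => ?_
    ring

end Q2Scheme

theorem mainTheorem1 (N : ℕ) (hN : 1 ≤ N) (x y : ℕ → ℝ)
    (hx : ∀ c < N, x c < x (c + 1)) (hy : ∀ c < N, y c < y (c + 1))
    (hmesh : Q2Scheme.MeshConstraint N x y) :
    (∀ u f : Q2Scheme.Grid N → ℝ,
      (Q2Scheme.fullMatrix N x y).mulVec u = f ↔ Q2Scheme.IsVariationalSolution N x y u f) ∧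
    Q2Scheme.IsMonotone (Q2Scheme.fullMatrix N x y) ∧
    Q2Scheme.DiscreteMaxPrinciple (Q2Scheme.fullMatrix N x y) := by
  have px : ∀ c < N, 0 < Q2Scheme.halfLen x c := fun c hc => half_pos (sub_pos.2 (hx c hc))
  have py : ∀ c < N, 0 < Q2Scheme.halfLen y c := fun c hc => half_pos (sub_pos.2 (hy c hc))
  have hb := hmesh.meshBounds px py
  exact ⟨Q2Scheme.mulVec_eq_iff_isVariationalSolution hN px py,
    Q2Scheme.isMonotone_of_nonneg fun _ => Q2Scheme.nonneg_of_mulVec_nonneg px py hb,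
    Q2Scheme.discreteMaxPrinciple_fullMatrix px py hb⟩
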